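/- Let $n\ge 1$ be an integer, let $q\in\left(1,1+\frac2n\right)$, and let $\Sigma\in\mathbb{R}^{n\times n}$ be symmetric positive definite. Consider all $\phi\in L^q(\mathbb{R}^n)$ such that $\phi\ge 0$ and $$\int_{\mathbb{R}^n}\phi(x)\,dx=1,\qquad \frac{\int_{\mathbb{R}^n} x\,\phi(x)^q\,dx}{\int_{\mathbb{R}^n}\phi(x)^q\,dx}=0,\qquad \frac{\int_{\mathbb{R}^n} xx^{T}\phi(x)^q\,dx}{\int_{\mathbb{R}^n}\phi(x)^q\,dx}=\Sigma ,$$ where the integrals are required to converge absolutely. Among these $\phi$, the problem of maximizing $$-\int_{\mathbb{R}^n}\phi(x)^q\,dx$$ has a unique solution up to equality almost everywhere, and it is given by the $q$-Gaussian density $$p(x;q,\Sigma)=\frac{1}{|\pi\Sigma|^{1/2}}\cdot\frac{\Gamma\left(\frac1{q-1}\right)}{\Gamma\left(\frac1{q-1}-\frac n2\right)}\cdot\left(\frac{2}{q-1}-n\right)^{-n/2}\cdot\left(1+\left(\frac{2}{q-1}-n\right)^{-1}\langle x,\Sigma^{-1}x\rangle\right)^{\frac1{1-q}},$$ where $|\cdot|$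 denotes the determinant. Equivalently, $p(\cdot\,;q,\Sigma)$ is the unique maximizer, over the same set, of the Tsallis entropy $$S_q(\phi)=-\int_{\mathbb{R}^n}\phi(x)^q\,\ln_q\phi(x)\,dx,\qquad \ln_q t=\frac{t^{1-q}-1}{1-q},$$ with the integrand read as $0$ where $\phi=0$. -/

import Mathlib

open MeasureTheory

noncomputable section

/-- The space `ℝⁿ` with its Euclidean structure and Lebesgue measure `volume`. -/
abbrev RVec (n : ℕ) : Type := EuclideanSpace ℝ (Fin n)

/-- The deformed logarithm `ln_q t = (t^(1-q) - 1) / (1 - q)`. -/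
def qLog (q t : ℝ) : ℝ := (t ^ (1 - q) - 1) / (1 - q)

/-- The (unnormalized) `q`-expectation `E_q f = ∫ f(x) φ(x)^q dx`. -/
def qExpectation {n : ℕ} (q : ℝ) (φ f : RVec n → ℝ) : ℝ :=
  ∫ x, f x * φ x ^ q

/-- The Tsallis entropy `S_q(φ) = - E_q (ln_q φ)`. -/
def tsallisEntropy {n : ℕ} (q : ℝ) (φ : RVec n → ℝ) : ℝ :=
  - qExpectation q φ (fun x => qLog q (φ x))

/-- The power-law objective `- ∫ φ(x)^q dx`. -/
def powerObjective {n : ℕ} (q : ℝ) (φ : RVec n → ℝ) : ℝ :=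
  - ∫ x, φ x ^ q

/-- The feasible set: probability densities in `L^q(ℝⁿ)` whose normalized first `q`-moment is `0`
and whose normalized second `q`-moment matrix (the `q`-covariance) is `S`. The moment integrals are
required to converge. -/
structure IsFeasibleDensity {n : ℕ} (q : ℝ) (S : Matrix (Fin n) (Fin n) ℝ)
    (φ : RVec n → ℝ) : Prop where
  memLp : MemLp φ (ENNReal.ofReal q) volume
  nonneg : ∀ᵐ x, 0 ≤ φ x
  integrable : Integrable φ volume
  integral_eq_one : ∫ x, φ x = 1
  integrable_first : ∀ i, Integrable (fun x : RVec n => x i * φ x ^ q) volume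
  first_moment : ∀ i, qExpectation q φ (fun x => x i) / (∫ x, φ x ^ q) = 0
  integrable_second : ∀ i j, Integrable (fun x : RVec n => x i * x j * φ x ^ q) volume
  second_moment : ∀ i j, qExpectation q φ (fun x => x i * x j) / (∫ x, φ x ^ q) = S i j

/-- `φ` solves the problem of maximizing `J` over the feasible densities. -/
def IsMaximizer {n : ℕ} (J : (RVec n → ℝ) → ℝ) (q : ℝ) (S : Matrix (Fin n) (Fin n) ℝ)
    (φ : RVec n → ℝ) : Prop :=
  IsFeasibleDensity q S φ ∧ ∀ ψ : RVec n → ℝ, IsFeasibleDensity q S ψ → J ψ ≤ J φ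

/-- `φ` is the unique solution, as an element of `L^q` (that is, up to almost everywhere
equality), of the problem of maximizing `J` over the feasible densities. -/
def IsUniqueMaximizer {n : ℕ} (J : (RVec n → ℝ) → ℝ) (q : ℝ) (S : Matrix (Fin n) (Fin n) ℝ)
    (φ : RVec n → ℝ) : Prop :=
  IsMaximizer J q S φ ∧ ∀ ψ : RVec n → ℝ, IsMaximizer J q S ψ → ψ =ᵐ[volume] φ

/-- The heavy-tailed multivariate `q`-Gaussian density with parameters `q` and `S`. -/
def qGaussianDensity {n : ℕ} (q : ℝ) (S : Matrix (Fin n) (Fin n) ℝ) (x : RVec n) : ℝ :=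
  1 / (Real.pi • S).det ^ (1 / 2 : ℝ)
    * (Real.Gamma (1 / (q - 1)) / Real.Gamma (1 / (q - 1) - (n : ℝ) / 2))
    * (2 / (q - 1) - (n : ℝ)) ^ (-((n : ℝ) / 2))
    * (1 + (2 / (q - 1) - (n : ℝ))⁻¹ * (x.ofLp ⬝ᵥ (S⁻¹).mulVec x.ofLp)) ^ (1 / (1 - q))

end

/-! Put m = 1/(q-1), a = 2m - n, w(x) = 1 + ⟨x, S⁻¹x⟩/a, and let p be the q-Gaussian. The
second-moment constraint and tr(S⁻¹S) = n give ∫ w φ^q = (1 + n/a) ∫ φ^q for every feasible φ, so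
minimizing ∫ φ^q amounts to minimizing ∫ w φ^q. As p is a multiple of w^(-m), the function w p^(q-1)
is constant. Multiply the tangent inequality φ^q ≥ p^q + q p^(q-1) (φ - p) by w and integrate: the
linear term vanishes because ∫ φ = ∫ p, and strictness gives uniqueness
(`weighted_rpow_integral_minimal`).

Feasibility of p is a computation: x = Tz with TTᵀ = aS turns w into 1 + ‖z‖², whose power integrals
are Gamma quotients (`integral_one_add_norm_sq_rpow_neg`), and symmetry gives the moments. The
Tsallis entropy is an increasing affine function of the power objective on the feasible set. -/

/-- The tangent line inequality for `t ↦ t ^ q`. -/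
theorem rpow_tangent_lt {q s t : ℝ} (hq : 1 < q) (hs : 0 < s) (ht : 0 ≤ t) (hne : t ≠ s) :
    s ^ q + q * s ^ (q - 1) * (t - s) < t ^ q := by
  -- Strict Bernoulli inequality at t/s - 1, to be scaled by s^q.
  have h := one_add_mul_self_lt_rpow_one_add (s := t / s - 1) (p := q)
    (by have := div_nonneg ht hs.le; linarith)
    (by rw [sub_ne_zero, Ne, div_eq_one_iff_eq hs.ne']; exact hne) hq
  rw [add_sub_cancel, Real.div_rpow ht hs.le, lt_div_iff₀ (Real.rpow_pos_of_pos hs q)] at h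
  have e : s ^ q = s ^ (q - 1) * s := by
    rw [← Real.rpow_add_one hs.ne']; congr 1; ring
  calc s ^ q + q * s ^ (q - 1) * (t - s) = (1 + q * (t / s - 1)) * s ^ q := by
        rw [e]; field_simp
    _ < t ^ q := h

theorem rpow_tangent_le {q s t : ℝ} (hq : 1 < q) (hs : 0 < s) (ht : 0 ≤ t) :
    s ^ q + q * s ^ (q - 1) * (t - s) ≤ t ^ q := by
  rcases eq_or_ne t s with rfl | hne
  · simp
  · exact (rpow_tangent_lt hq hs ht hne).le

/-- If `w * p ^ (q - 1)` is constant, then `p` minimizes `∫ w * ψ ^ q` among nonnegative functions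
of the same integral, and it is the only minimizer. -/
theorem weighted_rpow_integral_minimal {α : Type*} [MeasurableSpace α] {μ : Measure α} {q c : ℝ}
    (hq : 1 < q) {w p ψ : α → ℝ} (hw : ∀ x, 0 < w x) (hp : ∀ x, 0 < p x)
    (hc : ∀ x, w x * p x ^ (q - 1) = c) (hψ : ∀ᵐ x ∂μ, 0 ≤ ψ x)
    (hpi : Integrable p μ) (hψi : Integrable ψ μ) (hpw : Integrable (fun x => w x * p x ^ q) μ)
    (hψw : Integrable (fun x => w x * ψ x ^ q) μ) (h : ∫ x, ψ x ∂μ = ∫ x, p x ∂μ) :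
    ∫ x, w x * p x ^ q ∂μ ≤ ∫ x, w x * ψ x ^ q ∂μ ∧
      (∫ x, w x * p x ^ q ∂μ = ∫ x, w x * ψ x ^ q ∂μ → ψ =ᵐ[μ] p) := by
  -- The weighted gap to the tangent line; its linear term has the constant coefficient qc, so it
  -- integrates to zero.
  set D : α → ℝ := fun x => w x * ψ x ^ q - w x * p x ^ q - q * c * (ψ x - p x) with hD
  have eD : ∀ x, D x = w x * (ψ x ^ q - (p x ^ q + q * p x ^ (q - 1) * (ψ x - p x))) := by
    intro x; simp only [hD, ← hc x]; ring
  have hD0 : 0 ≤ᵐ[μ] D := by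
    filter_upwards [hψ] with x hx
    rw [eD]
    exact mul_nonneg (hw x).le (sub_nonneg.2 (rpow_tangent_le hq (hp x) hx))
  have h1 : Integrable (fun x => w x * ψ x ^ q - w x * p x ^ q) μ := hψw.sub hpw
  have h2 : Integrable (fun x => q * c * (ψ x - p x)) μ := (hψi.sub hpi).const_mul _
  have hDi : Integrable D μ := h1.sub h2
  have hint : ∫ x, D x ∂μ = ∫ x, w x * ψ x ^ q ∂μ - ∫ x, w x * p x ^ q ∂μ := by
    simp only [hD]
    rw [integral_sub h1 h2, integral_sub hψw hpw,
      integral_const_mul, integral_sub hψi hpi, h]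
    ring
  refine ⟨sub_nonneg.1 (hint ▸ integral_nonneg_of_ae hD0), fun heq => ?_⟩
  have hz : D =ᵐ[μ] 0 := (integral_eq_zero_iff_of_nonneg_ae hD0 hDi).1 (by rw [hint, heq, sub_self])
  filter_upwards [hz, hψ] with x hx hx0
  by_contra hne
  have := mul_pos (hw x) (sub_pos.2 (rpow_tangent_lt hq (hp x) hx0 hne))
  rw [← eD, hx] at this
  exact lt_irrefl _ this

/-! ### Integrals and second moments of powers of 1 + ‖z‖² -/

section Radial

variable {E : Type*} [NormedAddCommGroup E] [InnerProductSpace ℝ E] [FiniteDimensional ℝ E]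
  [MeasurableSpace E] [BorelSpace E]

theorem integrable_one_add_norm_sq_rpow_neg {s : ℝ} (hs : (Module.finrank ℝ E : ℝ) / 2 < s) :
    Integrable (fun z : E => (1 + ‖z‖ ^ 2) ^ (-s)) := by
  have := integrable_rpow_neg_one_add_norm_sq (E := E) (μ := volume) (r := 2 * s) (by linarith)
  simpa [neg_div] using this

/-- Write Γ(s) (1 + ‖z‖²)^(-s) as the integral of t^(s-1) exp(-(1 + ‖z‖²)t) over t > 0 and swap: the
Gaussian integral in z gives (π/t)^d with d half the dimension, leaving the integral for Γ(s - d).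
-/
theorem integral_one_add_norm_sq_rpow_neg {s : ℝ} (hs : (Module.finrank ℝ E : ℝ) / 2 < s) :
    ∫ z : E, (1 + ‖z‖ ^ 2) ^ (-s) = Real.pi ^ ((Module.finrank ℝ E : ℝ) / 2) *
      Real.Gamma (s - (Module.finrank ℝ E : ℝ) / 2) / Real.Gamma s := by
  set d : ℝ := (Module.finrank ℝ E : ℝ) / 2 with hd
  have hd0 : 0 ≤ d := by positivity
  have hs0 : 0 < s := hd0.trans_lt hs
  have inner : ∀ z : E, ∫ t in Set.Ioi (0 : ℝ), t ^ (s - 1) * Real.exp (-((1 + ‖z‖ ^ 2) * t))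
      = Real.Gamma s * (1 + ‖z‖ ^ 2) ^ (-s) := by
    intro z
    rw [Real.integral_rpow_mul_exp_neg_mul_Ioi hs0 (by positivity), one_div,
      Real.inv_rpow (by positivity), ← Real.rpow_neg (by positivity), mul_comm]
  have hint : Integrable (Function.uncurry fun (z : E) (t : ℝ) =>
      t ^ (s - 1) * Real.exp (-((1 + ‖z‖ ^ 2) * t)))
      (volume.prod (volume.restrict (Set.Ioi (0 : ℝ)))) := by
    rw [integrable_prod_iff (by
      apply Measurable.aestronglyMeasurable; unfold Function.uncurry; fun_prop)]
    refine ⟨.of_forall fun z => ?_, ?_⟩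
    -- A nonintegrable function would have integral 0, but the value is positive.
    · refine not_imp_comm.1 integral_undef ?_
      simp only [Function.uncurry]
      rw [inner]
      have := Real.Gamma_pos_of_pos hs0
      positivity
    · refine ((integrable_one_add_norm_sq_rpow_neg hs).const_mul (Real.Gamma s)).congr
        (.of_forall fun z => ?_)
      simp only [Function.uncurry]
      rw [← inner]
      refine setIntegral_congr_fun measurableSet_Ioi fun t ht => ?_
      have : (0 : ℝ) < t := ht
      exact (Real.norm_of_nonneg (by positivity)).symm
  rw [eq_div_iff (Real.Gamma_pos_of_pos hs0).ne', mul_comm, ← integral_const_mul]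
  simp_rw [← inner]
  rw [integral_integral_swap hint]
  have outer : ∀ t ∈ Set.Ioi (0 : ℝ),
      ∫ z : E, t ^ (s - 1) * Real.exp (-((1 + ‖z‖ ^ 2) * t))
      = Real.pi ^ d * (t ^ (s - d - 1) * Real.exp (-(1 * t))) := by
    intro t ht
    have ht : 0 < t := ht
    have e : ∀ z : E, t ^ (s - 1) * Real.exp (-((1 + ‖z‖ ^ 2) * t))
        = t ^ (s - 1) * Real.exp (-(1 * t)) * Real.exp (-t * ‖z‖ ^ 2) := by
      intro z; rw [mul_assoc, ← Real.exp_add]; congr 2; ring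
    simp_rw [e]
    rw [integral_const_mul, GaussianFourier.integral_rexp_neg_mul_sq_norm ht, ← hd,
      Real.div_rpow Real.pi_pos.le ht.le, show s - d - 1 = (s - 1) - d by ring,
      Real.rpow_sub ht (s - 1) d]
    ring
  rw [setIntegral_congr_fun measurableSet_Ioi outer, integral_const_mul,
    Real.integral_rpow_mul_exp_neg_mul_Ioi (by linarith) one_pos]
  simp

end Radial

theorem integrable_coord_mul_coord_mul {n : ℕ} {s : ℝ} (hs : (n : ℝ) / 2 < s) (k l : Fin n) :
    Integrable (fun z : RVec n => z k * z l * (1 + ‖z‖ ^ 2) ^ (-(s + 1))) := by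
  have hi := integrable_one_add_norm_sq_rpow_neg (E := RVec n) (s := s) (by simpa using hs)
  refine hi.mono' (by apply Measurable.aestronglyMeasurable; fun_prop) (.of_forall fun z => ?_)
  have h1 : 0 < 1 + ‖z‖ ^ 2 := by positivity
  have hk := PiLp.norm_apply_le z k
  have hl := PiLp.norm_apply_le z l
  rw [norm_mul, norm_mul, Real.norm_of_nonneg (Real.rpow_nonneg h1.le _)]
  calc ‖z k‖ * ‖z l‖ * (1 + ‖z‖ ^ 2) ^ (-(s + 1))
      ≤ (1 + ‖z‖ ^ 2) * (1 + ‖z‖ ^ 2) ^ (-(s + 1)) := by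
        gcongr
        nlinarith [norm_nonneg (z k), norm_nonneg (z l), norm_nonneg z]
    _ = (1 + ‖z‖ ^ 2) ^ (-s) := by
        rw [mul_comm, ← Real.rpow_add_one h1.ne']; congr 1; ring

/-- Reflecting the k-th coordinate preserves the measure and flips the sign. -/
theorem integral_coord_mul_coord_mul_of_ne {n : ℕ} (g : ℝ → ℝ) {k l : Fin n} (hkl : k ≠ l) :
    ∫ z : RVec n, z k * z l * g ‖z‖ = 0 := by
  let R : RVec n ≃ₗᵢ[ℝ] RVec n := LinearIsometryEquiv.piLpCongrRight 2
    (fun i => if i = k then LinearIsometryEquiv.neg ℝ else LinearIsometryEquiv.refl ℝ ℝ)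
  have h := integral_comp R (fun z : RVec n => z k * z l * g ‖z‖)
  have e : ∀ z : RVec n, R z k * R z l * g ‖R z‖ = -(z k * z l * g ‖z‖) := by
    intro z
    rw [R.norm_map]
    simp [R, hkl.symm]
  simp_rw [e, integral_neg] at h
  linarith

theorem integral_coord_sq_mul_eq {n : ℕ} (g : ℝ → ℝ) (k l : Fin n) :
    ∫ z : RVec n, z k * z k * g ‖z‖ = ∫ z : RVec n, z l * z l * g ‖z‖ := by
  let R : RVec n ≃ₗᵢ[ℝ] RVec n := LinearIsometryEquiv.piLpCongrLeft 2 ℝ ℝ (Equiv.swap k l)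
  rw [← integral_comp R (fun z : RVec n => z k * z k * g ‖z‖)]
  refine integral_congr_ae (.of_forall fun z => ?_)
  simp only [R.norm_map]
  simp [R, LinearIsometryEquiv.piLpCongrLeft_apply, Equiv.piCongrLeft']

/-- The second moments of the unnormalized standard `q`-Gaussian. -/
theorem integral_coord_mul_coord_mul {n : ℕ} {s : ℝ} (hs : (n : ℝ) / 2 < s) (k l : Fin n) :
    ∫ z : RVec n, z k * z l * (1 + ‖z‖ ^ 2) ^ (-(s + 1))
      = if k = l then (2 * s - n)⁻¹ * ∫ z : RVec n, (1 + ‖z‖ ^ 2) ^ (-(s + 1)) else 0 := by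
  split_ifs with hkl
  swap
  · exact integral_coord_mul_coord_mul_of_ne (fun t => (1 + t ^ 2) ^ (-(s + 1))) hkl
  subst hkl
  have hn : (n : ℝ) ≠ 0 := by
    have := k.pos; positivity
  have hs0 : 0 < s := lt_of_le_of_lt (by positivity) hs
  have hfr : ((Module.finrank ℝ (RVec n) : ℕ) : ℝ) = n := by simp
  have hi := integrable_one_add_norm_sq_rpow_neg (E := RVec n) (s := s) (by rwa [hfr])
  have hi' := integrable_one_add_norm_sq_rpow_neg (E := RVec n) (s := s + 1)
    (by rw [hfr]; linarith)
  have hv := integral_one_add_norm_sq_rpow_neg (E := RVec n) (s := s) (by rwa [hfr])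
  have hv' := integral_one_add_norm_sq_rpow_neg (E := RVec n) (s := s + 1)
    (by rw [hfr]; linarith)
  rw [hfr] at hv hv'
  rw [Real.Gamma_add_one hs0.ne', show s + 1 - (n : ℝ) / 2 = (s - n / 2) + 1 by ring,
    Real.Gamma_add_one (sub_pos.2 hs).ne'] at hv'
  -- Since ‖z‖² = (1 + ‖z‖²) - 1, the n equal diagonal moments sum to I(s) - I(s+1), with I(s) = ∫
  -- (1 + ‖z‖²)^(-s). The Gamma recursion makes this I(s+1) n/(2s - n).
  have hsum : ∑ l : Fin n, ∫ z : RVec n, z l * z l * (1 + ‖z‖ ^ 2) ^ (-(s + 1))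
      = (∫ z : RVec n, (1 + ‖z‖ ^ 2) ^ (-s)) - ∫ z : RVec n, (1 + ‖z‖ ^ 2) ^ (-(s + 1)) := by
    rw [← integral_finsetSum _ fun l _ => integrable_coord_mul_coord_mul hs l l,
      ← integral_sub hi hi']
    refine integral_congr_ae (.of_forall fun z => ?_)
    have h1 : 0 < 1 + ‖z‖ ^ 2 := by positivity
    have hz : ∑ l, z l * z l = ‖z‖ ^ 2 := by
      rw [EuclideanSpace.real_norm_sq_eq]; simp [sq]
    have e : (1 + ‖z‖ ^ 2) ^ (-s) = (1 + ‖z‖ ^ 2) ^ (-(s + 1)) * (1 + ‖z‖ ^ 2) := by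
      rw [← Real.rpow_add_one h1.ne']; congr 1; ring
    simp only [← Finset.sum_mul, hz]
    rw [e]; ring
  rw [Finset.sum_congr rfl fun l _ =>
    integral_coord_sq_mul_eq (fun t => (1 + t ^ 2) ^ (-(s + 1))) l k, Finset.sum_const,
    Finset.card_univ, Fintype.card_fin, nsmul_eq_mul, hv, hv'] at hsum
  rw [hv', ← mul_right_inj' hn, hsum]
  have hG : Real.Gamma s ≠ 0 := (Real.Gamma_pos_of_pos hs0).ne'
  have h2 : 2 * s - n ≠ 0 := by linarith
  field_simp
  ring

/-! ### Linear change of variables -/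

section LinearChange

variable {E : Type*} [NormedAddCommGroup E] [NormedSpace ℝ E] [FiniteDimensional ℝ E]
  [MeasurableSpace E] [BorelSpace E] {μ : Measure E} [μ.IsAddHaarMeasure]

theorem measurableEmbedding_linearMap {L : E →ₗ[ℝ] E} (hL : LinearMap.det L ≠ 0) :
    MeasurableEmbedding L :=
  (LinearMap.equivOfDetNeZero L hL).toContinuousLinearEquiv.toHomeomorph.measurableEmbedding

theorem integral_eq_abs_det_mul_integral_comp {L : E →ₗ[ℝ] E} (hL : LinearMap.det L ≠ 0)
    (f : E → ℝ) : ∫ x, f x ∂μ = |LinearMap.det L| * ∫ z, f (L z) ∂μ := by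
  rw [← (measurableEmbedding_linearMap hL).integral_map,
    Measure.map_linearMap_addHaar_eq_smul_addHaar μ hL, integral_smul_measure,
    ENNReal.toReal_ofReal (abs_nonneg _), smul_eq_mul, abs_inv, ← mul_assoc,
    mul_inv_cancel₀ (abs_ne_zero.2 hL), one_mul]

theorem integrable_comp_linearMap_iff {L : E →ₗ[ℝ] E} (hL : LinearMap.det L ≠ 0) {f : E → ℝ} :
    Integrable (fun z => f (L z)) μ ↔ Integrable f μ := by
  have h := (measurableEmbedding_linearMap hL).integrable_map_iff (μ := μ) (g := f)
  rw [Measure.map_linearMap_addHaar_eq_smul_addHaar μ hL, integrable_smul_measure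
    (by simpa using hL) ENNReal.ofReal_ne_top] at h
  exact h.symm

end LinearChange

open scoped MatrixOrder in
theorem Matrix.PosDef.exists_mul_transpose_eq {n : ℕ} {A : Matrix (Fin n) (Fin n) ℝ}
    (hA : A.PosDef) : ∃ T : Matrix (Fin n) (Fin n) ℝ, T * T.transpose = A := by
  obtain ⟨B, hB⟩ := CStarAlgebra.nonneg_iff_eq_star_mul_self.mp hA.posSemidef.nonneg
  refine ⟨B.transpose, ?_⟩
  rw [hB, Matrix.star_eq_conjTranspose, Matrix.conjTranspose_eq_transpose_of_trivial,
    Matrix.transpose_transpose]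

/-! ### The quadratic weight of a general matrix -/

/-- The quadratic weight `1 + ⟨x, S⁻¹ x⟩ / a`. -/
noncomputable def qWeight {n : ℕ} (a : ℝ) (S : Matrix (Fin n) (Fin n) ℝ) (x : RVec n) : ℝ :=
  1 + a⁻¹ * (x.ofLp ⬝ᵥ (S⁻¹).mulVec x.ofLp)

section Weight

variable {n : ℕ} {a : ℝ} {S T : Matrix (Fin n) (Fin n) ℝ}

theorem qWeight_pos (ha : 0 < a) (hS : S.PosDef) (x : RVec n) : 0 < qWeight a S x := by
  have := hS.inv.posSemidef.dotProduct_mulVec_nonneg x.ofLp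
  simp only [star_trivial] at this
  unfold qWeight
  positivity

theorem det_ne_zero_of_mul_transpose_eq (ha : 0 < a) (hS : S.PosDef) (hT : T * T.transpose = a • S) :
    T.det ≠ 0 := by
  intro h
  have h2 := congrArg Matrix.det hT
  rw [Matrix.det_mul, h, zero_mul, Matrix.det_smul] at h2
  exact (mul_pos (pow_pos ha _) hS.det_pos).ne h2

theorem abs_det_eq_of_mul_transpose_eq (ha : 0 < a) (hS : S.PosDef) (hT : T * T.transpose = a • S) :
    |T.det| = a ^ ((n : ℝ) / 2) * S.det ^ (1 / 2 : ℝ) := by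
  have h2 := congrArg Matrix.det hT
  rw [Matrix.det_mul, Matrix.det_transpose, Matrix.det_smul, Fintype.card_fin] at h2
  rw [← Real.sqrt_mul_self_eq_abs, h2, Real.sqrt_eq_rpow,
    Real.mul_rpow (by positivity) hS.det_pos.le, ← Real.rpow_natCast_mul ha.le]
  ring_nf

/-- Here Tᵀ(aS)⁻¹T = 1, so every integral of the weight reduces to a radial one. -/
theorem qWeight_toEuclideanLin (ha : 0 < a) (hS : S.PosDef) (hT : T * T.transpose = a • S)
    (z : RVec n) : qWeight a S (T.toEuclideanLin z) = 1 + ‖z‖ ^ 2 := by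
  have hu : IsUnit T.det := (det_ne_zero_of_mul_transpose_eq ha hS hT).isUnit
  have hu' : IsUnit T.transpose.det := by rwa [Matrix.det_transpose]
  have e : a⁻¹ • S⁻¹ = T.transpose⁻¹ * T⁻¹ := by
    rw [← Matrix.mul_inv_rev, hT]
    exact (Matrix.inv_smul' S (Units.mk0 a ha.ne') hS.det_pos.ne'.isUnit).symm
  have e2 : T.transpose * ((T.transpose⁻¹ * T⁻¹) * T) = 1 := by
    rw [Matrix.mul_assoc, Matrix.nonsing_inv_mul _ hu, Matrix.mul_one,
      Matrix.mul_nonsing_inv _ hu']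
  unfold qWeight
  rw [← smul_eq_mul, ← dotProduct_smul, ← Matrix.smul_mulVec, e,
    Matrix.ofLp_toLpLin, Matrix.toLin'_apply, Matrix.mulVec_mulVec, Matrix.dotProduct_mulVec,
    ← Matrix.vecMul_transpose, Matrix.vecMul_vecMul, e2, Matrix.vecMul_one,
    EuclideanSpace.real_norm_sq_eq]
  simp [dotProduct, sq]

theorem integrable_qWeight_rpow_neg (ha : 0 < a) (hS : S.PosDef) {s : ℝ} (hs : (n : ℝ) / 2 < s) :
    Integrable (fun x => qWeight a S x ^ (-s)) := by
  obtain ⟨T, hT⟩ := (hS.smul ha).exists_mul_transpose_eq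
  rw [← integrable_comp_linearMap_iff (L := T.toEuclideanLin)
    (by rw [LinearMap.det_toLpLin]; exact det_ne_zero_of_mul_transpose_eq ha hS hT)]
  simp_rw [qWeight_toEuclideanLin ha hS hT]
  exact integrable_one_add_norm_sq_rpow_neg (by simpa using hs)

theorem integral_qWeight_rpow_neg (ha : 0 < a) (hS : S.PosDef) {s : ℝ} (hs : (n : ℝ) / 2 < s) :
    ∫ x, qWeight a S x ^ (-s) = a ^ ((n : ℝ) / 2) * S.det ^ (1 / 2 : ℝ) *
      (Real.pi ^ ((n : ℝ) / 2) * Real.Gamma (s - (n : ℝ) / 2) / Real.Gamma s) := by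
  obtain ⟨T, hT⟩ := (hS.smul ha).exists_mul_transpose_eq
  rw [integral_eq_abs_det_mul_integral_comp (L := T.toEuclideanLin)
    (by rw [LinearMap.det_toLpLin]; exact det_ne_zero_of_mul_transpose_eq ha hS hT)]
  simp_rw [qWeight_toEuclideanLin ha hS hT]
  rw [integral_one_add_norm_sq_rpow_neg (by simpa using hs), LinearMap.det_toLpLin,
    abs_det_eq_of_mul_transpose_eq ha hS hT]
  simp

theorem toEuclideanLin_coord_mul_coord (z : RVec n) (i j : Fin n) (c : ℝ) :
    T.toEuclideanLin z i * T.toEuclideanLin z j * c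
      = ∑ k, ∑ l, T i k * T j l * (z k * z l * c) := by
  simp only [Matrix.ofLp_toLpLin, Matrix.toLin'_apply, Matrix.mulVec, dotProduct]
  rw [Finset.sum_mul_sum]
  simp only [Finset.sum_mul]
  exact Finset.sum_congr rfl fun k _ => Finset.sum_congr rfl fun l _ => by ring

theorem integrable_coord_mul_coord_mul_qWeight (ha : 0 < a) (hS : S.PosDef) {s : ℝ}
    (hs : (n : ℝ) / 2 < s) (i j : Fin n) :
    Integrable (fun x : RVec n => x i * x j * qWeight a S x ^ (-(s + 1))) := by
  obtain ⟨T, hT⟩ := (hS.smul ha).exists_mul_transpose_eq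
  rw [← integrable_comp_linearMap_iff (L := T.toEuclideanLin)
    (by rw [LinearMap.det_toLpLin]; exact det_ne_zero_of_mul_transpose_eq ha hS hT)]
  simp_rw [qWeight_toEuclideanLin ha hS hT, toEuclideanLin_coord_mul_coord]
  exact integrable_finsetSum _ fun k _ => integrable_finsetSum _ fun l _ =>
    (integrable_coord_mul_coord_mul hs k l).const_mul _

/-- The scale a = 2s - n is forced: TTᵀ = aS contributes a factor a that cancels the (2s - n)⁻¹ of
the standard second moments. -/
theorem integral_coord_mul_coord_mul_qWeight {s : ℝ} (hs : (n : ℝ) / 2 < s) (hS : S.PosDef)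
    (i j : Fin n) :
    ∫ x : RVec n, x i * x j * qWeight (2 * s - n) S x ^ (-(s + 1))
      = S i j * ∫ x, qWeight (2 * s - n) S x ^ (-(s + 1)) := by
  have ha : 0 < 2 * s - n := by linarith
  obtain ⟨T, hT⟩ := (hS.smul ha).exists_mul_transpose_eq
  have hL : LinearMap.det T.toEuclideanLin ≠ 0 := by
    rw [LinearMap.det_toLpLin]; exact det_ne_zero_of_mul_transpose_eq ha hS hT
  rw [integral_eq_abs_det_mul_integral_comp hL,
    integral_eq_abs_det_mul_integral_comp (f := fun x => qWeight _ S x ^ _) hL]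
  simp_rw [qWeight_toEuclideanLin ha hS hT, toEuclideanLin_coord_mul_coord]
  rw [integral_finsetSum _ fun k _ => integrable_finsetSum _ fun l _ =>
    (integrable_coord_mul_coord_mul hs k l).const_mul _]
  simp_rw [integral_finsetSum _ fun l _ =>
    (integrable_coord_mul_coord_mul hs _ l).const_mul _, integral_const_mul,
    integral_coord_mul_coord_mul hs, mul_ite, mul_zero, Finset.sum_ite_eq, Finset.mem_univ,
    if_true, ← Finset.sum_mul]
  have hij : ∑ k, T i k * T j k = (2 * s - n) * S i j := by
    have := congrFun (congrFun hT i) j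
    simpa [Matrix.mul_apply] using this
  rw [hij]
  field_simp

theorem qWeight_neg (x : RVec n) : qWeight a S (-x) = qWeight a S x := by
  simp [qWeight, Matrix.mulVec_neg]

theorem measurable_qWeight : Measurable (qWeight a S) := by
  unfold qWeight dotProduct Matrix.mulVec dotProduct
  fun_prop

end Weight

/-! ### Positivity, normalization and feasibility of the q-Gaussian -/

/-- The normalizing constant of the `q`-Gaussian density. -/
noncomputable def qGaussianConst {n : ℕ} (q : ℝ) (S : Matrix (Fin n) (Fin n) ℝ) : ℝ :=
  1 / (Real.pi • S).det ^ (1 / 2 : ℝ)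
    * (Real.Gamma (1 / (q - 1)) / Real.Gamma (1 / (q - 1) - (n : ℝ) / 2))
    * (2 / (q - 1) - (n : ℝ)) ^ (-((n : ℝ) / 2))

section QGaussian

variable {n : ℕ} {q : ℝ} {S : Matrix (Fin n) (Fin n) ℝ}

theorem half_dim_lt (hn : 0 < n) (hq : 1 < q) (hqn : q < 1 + 2 / (n : ℝ)) :
    (n : ℝ) / 2 < 1 / (q - 1) := by
  have hn' : (0 : ℝ) < n := by exact_mod_cast hn
  have h : q - 1 < 2 / n := by linarith
  rw [lt_div_iff₀ hn'] at h
  rw [div_lt_div_iff₀ two_pos (sub_pos.2 hq)]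
  linarith

theorem qGaussianConst_pos (hq : 1 < q) (hm : (n : ℝ) / 2 < 1 / (q - 1)) (hS : S.PosDef) :
    0 < qGaussianConst q S := by
  have h1 : 0 < (Real.pi • S).det := (hS.smul Real.pi_pos).det_pos
  have h2 := Real.Gamma_pos_of_pos (show 0 < 1 / (q - 1) from one_div_pos.2 (sub_pos.2 hq))
  have h3 := Real.Gamma_pos_of_pos (sub_pos.2 hm)
  have h4 : 0 < 2 / (q - 1) - (n : ℝ) := by
    rw [show 2 / (q - 1) = 2 * (1 / (q - 1)) by ring]; linarith
  unfold qGaussianConst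
  positivity

theorem qGaussianDensity_eq (x : RVec n) :
    qGaussianDensity q S x
      = qGaussianConst q S * qWeight (2 * (1 / (q - 1)) - n) S x ^ (-(1 / (q - 1))) := by
  unfold qGaussianDensity qGaussianConst qWeight
  rw [show 2 * (1 / (q - 1)) = 2 / (q - 1) by ring,
    show 1 / (1 - q) = -(1 / (q - 1)) by rw [← neg_sub q 1, div_neg]]

theorem qGaussianDensity_pos (hq : 1 < q) (hm : (n : ℝ) / 2 < 1 / (q - 1)) (hS : S.PosDef)
    (x : RVec n) : 0 < qGaussianDensity q S x := by
  rw [qGaussianDensity_eq]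
  exact mul_pos (qGaussianConst_pos hq hm hS)
    (Real.rpow_pos_of_pos (qWeight_pos (by linarith) hS x) _)

theorem qGaussianDensity_rpow (hq : 1 < q) (hm : (n : ℝ) / 2 < 1 / (q - 1)) (hS : S.PosDef)
    (x : RVec n) : qGaussianDensity q S x ^ q
      = qGaussianConst q S ^ q * qWeight (2 * (1 / (q - 1)) - n) S x ^ (-(1 / (q - 1) + 1)) := by
  have hw := qWeight_pos (a := 2 * (1 / (q - 1)) - n) (by linarith) hS x
  have hq' : q - 1 ≠ 0 := (sub_pos.2 hq).ne'
  rw [qGaussianDensity_eq, Real.mul_rpow (qGaussianConst_pos hq hm hS).le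
    (Real.rpow_nonneg hw.le _), ← Real.rpow_mul hw.le]
  -- The exponents agree because q/(q-1) = 1/(q-1) + 1.
  congr 2
  field_simp
  ring

/-- This is the Lagrange condition that makes the tangent term integrate to zero. -/
theorem qWeight_mul_qGaussianDensity_rpow (hq : 1 < q) (hm : (n : ℝ) / 2 < 1 / (q - 1))
    (hS : S.PosDef) (x : RVec n) :
    qWeight (2 * (1 / (q - 1)) - n) S x * qGaussianDensity q S x ^ (q - 1)
      = qGaussianConst q S ^ (q - 1) := by
  have hw := qWeight_pos (a := 2 * (1 / (q - 1)) - n) (by linarith) hS x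
  have hq' : q - 1 ≠ 0 := (sub_pos.2 hq).ne'
  rw [qGaussianDensity_eq, Real.mul_rpow (qGaussianConst_pos hq hm hS).le
    (Real.rpow_nonneg hw.le _), ← Real.rpow_mul hw.le,
    show -(1 / (q - 1)) * (q - 1) = -1 by field_simp, Real.rpow_neg_one,
    mul_left_comm, mul_inv_cancel₀ hw.ne', mul_one]

theorem integrable_qGaussianDensity (hm : (n : ℝ) / 2 < 1 / (q - 1)) (hS : S.PosDef) :
    Integrable (qGaussianDensity q S) := by
  rw [funext qGaussianDensity_eq]
  exact (integrable_qWeight_rpow_neg (by linarith) hS hm).const_mul _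

theorem integral_qGaussianDensity (hq : 1 < q) (hm : (n : ℝ) / 2 < 1 / (q - 1))
    (hS : S.PosDef) : ∫ x, qGaussianDensity q S x = 1 := by
  have ha : 0 < 2 * (1 / (q - 1)) - (n : ℝ) := by linarith
  have h2 := Real.Gamma_pos_of_pos (show 0 < 1 / (q - 1) from one_div_pos.2 (sub_pos.2 hq))
  have h3 := Real.Gamma_pos_of_pos (sub_pos.2 hm)
  have hd := hS.det_pos
  simp_rw [qGaussianDensity_eq]
  rw [integral_const_mul, integral_qWeight_rpow_neg ha hS hm, qGaussianConst,
    show 2 / (q - 1) = 2 * (1 / (q - 1)) by ring, Matrix.det_smul, Fintype.card_fin,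
    Real.mul_rpow (by positivity) hd.le, ← Real.rpow_natCast_mul Real.pi_pos.le,
    Real.rpow_neg ha.le, show (n : ℝ) * (1 / 2) = n / 2 by ring]
  have h4 := Real.rpow_pos_of_pos ha ((n : ℝ) / 2)
  have h5 := Real.rpow_pos_of_pos hd (1 / 2 : ℝ)
  have h6 := Real.rpow_pos_of_pos Real.pi_pos ((n : ℝ) / 2)
  generalize (2 * (1 / (q - 1)) - (n : ℝ)) ^ ((n : ℝ) / 2) = A at *
  generalize S.det ^ (1 / 2 : ℝ) = B at *
  generalize Real.pi ^ ((n : ℝ) / 2) = P at *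
  generalize Real.Gamma (1 / (q - 1)) = G at *
  generalize Real.Gamma (1 / (q - 1) - (n : ℝ) / 2) = G' at *
  field_simp

theorem integrable_qGaussianDensity_rpow (hq : 1 < q) (hm : (n : ℝ) / 2 < 1 / (q - 1))
    (hS : S.PosDef) : Integrable (fun x => qGaussianDensity q S x ^ q) := by
  simp_rw [qGaussianDensity_rpow hq hm hS]
  exact (integrable_qWeight_rpow_neg (by linarith) hS (by linarith)).const_mul _

theorem integral_qGaussianDensity_rpow_pos (hq : 1 < q) (hm : (n : ℝ) / 2 < 1 / (q - 1))
    (hS : S.PosDef) : 0 < ∫ x, qGaussianDensity q S x ^ q := by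
  have hp := fun x => Real.rpow_pos_of_pos (qGaussianDensity_pos hq hm hS x) q
  rw [integral_pos_iff_support_of_nonneg (fun x => (hp x).le)
    (integrable_qGaussianDensity_rpow hq hm hS),
    show (Function.support fun x => qGaussianDensity q S x ^ q) = Set.univ from
      Set.eq_univ_of_forall fun x => (hp x).ne']
  exact Measure.measure_univ_pos.2 (NeZero.ne _)

theorem qGaussianDensity_neg (x : RVec n) : qGaussianDensity q S (-x) = qGaussianDensity q S x := by
  rw [qGaussianDensity_eq, qGaussianDensity_eq, qWeight_neg]

theorem integrable_coord_mul_coord_mul_qGaussianDensity (hq : 1 < q)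
    (hm : (n : ℝ) / 2 < 1 / (q - 1)) (hS : S.PosDef) (i j : Fin n) :
    Integrable (fun x : RVec n => x i * x j * qGaussianDensity q S x ^ q) := by
  refine ((integrable_coord_mul_coord_mul_qWeight (a := 2 * (1 / (q - 1)) - n) (by linarith) hS hm
    i j).const_mul (qGaussianConst q S ^ q)).congr (.of_forall fun x => ?_)
  simp only [qGaussianDensity_rpow hq hm hS]
  ring

theorem measurable_qGaussianDensity : Measurable (qGaussianDensity q S) := by
  rw [funext qGaussianDensity_eq]
  exact (measurable_qWeight.pow_const _).const_mul _

theorem isFeasibleDensity_qGaussianDensity (hq : 1 < q) (hm : (n : ℝ) / 2 < 1 / (q - 1))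
    (hS : S.PosDef) : IsFeasibleDensity q S (qGaussianDensity q S) where
  memLp := by
    rw [← integrable_norm_rpow_iff measurable_qGaussianDensity.aestronglyMeasurable
      (by simp; linarith) ENNReal.ofReal_ne_top, ENNReal.toReal_ofReal (by linarith)]
    simp_rw [fun x => Real.norm_of_nonneg (qGaussianDensity_pos hq hm hS x).le]
    exact integrable_qGaussianDensity_rpow hq hm hS
  nonneg := .of_forall fun x => (qGaussianDensity_pos hq hm hS x).le
  integrable := integrable_qGaussianDensity hm hS
  integral_eq_one := integral_qGaussianDensity hq hm hS
  integrable_first i := by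
    refine ((integrable_qGaussianDensity_rpow hq hm hS).add
      (integrable_coord_mul_coord_mul_qGaussianDensity hq hm hS i i)).mono'
      (((by fun_prop : Measurable fun x : RVec n => x i).mul
        (measurable_qGaussianDensity.pow_const _)).aestronglyMeasurable) (.of_forall fun x => ?_)
    have h0 := Real.rpow_nonneg (qGaussianDensity_pos hq hm hS x).le q
    rw [norm_mul, Real.norm_of_nonneg h0, Pi.add_apply, ← one_add_mul]
    gcongr
    rw [Real.norm_eq_abs, ← abs_mul_abs_self (x i)]
    -- The bound |t| ≤ 1 + t² dominates the first moment by the mass and the second moment.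
    nlinarith [sq_nonneg (|x i| - 1), abs_nonneg (x i)]
  first_moment i := by
    have h : qExpectation q (qGaussianDensity q S) (fun x : RVec n => x i) = 0 := by
      unfold qExpectation
      have := integral_neg_eq_self (fun x : RVec n => x i * qGaussianDensity q S x ^ q) volume
      simp only [qGaussianDensity_neg, PiLp.neg_apply, neg_mul, integral_neg] at this
      linarith
    rw [h, zero_div]
  integrable_second := integrable_coord_mul_coord_mul_qGaussianDensity hq hm hS
  second_moment i j := by
    rw [div_eq_iff (integral_qGaussianDensity_rpow_pos hq hm hS).ne', qExpectation]
    simp_rw [qGaussianDensity_rpow hq hm hS, mul_left_comm _ (qGaussianConst q S ^ q)]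
    rw [integral_const_mul, integral_const_mul, integral_coord_mul_coord_mul_qWeight hm hS]
    ring

end QGaussian

/-! ### Consequences of the constraints -/

namespace IsFeasibleDensity

variable {n : ℕ} {q : ℝ} {S : Matrix (Fin n) (Fin n) ℝ} {φ : RVec n → ℝ}

theorem integrable_rpow (hq : 1 < q) (h : IsFeasibleDensity q S φ) :
    Integrable (fun x => φ x ^ q) := by
  have := h.memLp.integrable_norm_rpow (by simp; linarith) ENNReal.ofReal_ne_top
  rw [ENNReal.toReal_ofReal (by linarith)] at this
  refine this.congr ?_
  filter_upwards [h.nonneg] with x hx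
  rw [Real.norm_of_nonneg hx]

theorem integral_coord_mul_coord_mul_rpow (hn : 0 < n) (hS : S.PosDef)
    (h : IsFeasibleDensity q S φ) (i j : Fin n) :
    ∫ x : RVec n, x i * x j * φ x ^ q = S i j * ∫ x, φ x ^ q := by
  have h0 : ∫ x, φ x ^ q ≠ 0 := by
    -- Division by zero yields 0, so a vanishing denominator would force a zero diagonal entry of S.
    intro h0
    have := h.second_moment ⟨0, hn⟩ ⟨0, hn⟩
    rw [h0, div_zero] at this
    exact hS.diag_pos.ne this
  exact (div_eq_iff h0).1 (h.second_moment i j)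

theorem qWeight_mul_rpow_eq (a : ℝ) (x : RVec n) : qWeight a S x * φ x ^ q
    = φ x ^ q + a⁻¹ * ∑ i, ∑ j, S⁻¹ i j * (x i * x j * φ x ^ q) := by
  simp only [qWeight, dotProduct, Matrix.mulVec, Finset.mul_sum, add_mul, one_mul, Finset.sum_mul]
  congr 1
  exact Finset.sum_congr rfl fun i _ => Finset.sum_congr rfl fun j _ => by ring

theorem integrable_qWeight_mul_rpow (hq : 1 < q) (h : IsFeasibleDensity q S φ) (a : ℝ) :
    Integrable (fun x => qWeight a S x * φ x ^ q) := by
  simp_rw [qWeight_mul_rpow_eq]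
  exact (h.integrable_rpow hq).add ((integrable_finsetSum _ fun i _ => integrable_finsetSum _
    fun j _ => (h.integrable_second i j).const_mul _).const_mul _)

/-- On feasible densities the weighted integral is proportional to the power objective. -/
theorem integral_qWeight_mul_rpow (hn : 0 < n) (hq : 1 < q) (hS : S.PosDef)
    (h : IsFeasibleDensity q S φ) (a : ℝ) :
    ∫ x, qWeight a S x * φ x ^ q = (1 + a⁻¹ * n) * ∫ x, φ x ^ q := by
  have hi := fun i j => (h.integrable_second i j).const_mul (S⁻¹ i j)
  have htr : ∑ i, ∑ j, S⁻¹ i j * S i j = n := by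
    have h1 : S⁻¹ * S = 1 := Matrix.nonsing_inv_mul _ hS.det_pos.ne'.isUnit
    have h2 : ∀ i j, S j i = S i j := fun i j => by simpa using hS.isHermitian.apply i j
    have h3 := congrArg Matrix.trace h1
    simpa [Matrix.trace, Matrix.mul_apply, h2] using h3
  simp_rw [qWeight_mul_rpow_eq]
  rw [integral_add (h.integrable_rpow hq) ((integrable_finsetSum _ fun i _ =>
    integrable_finsetSum _ fun j _ => hi i j).const_mul _), integral_const_mul,
    integral_finsetSum _ fun i _ => integrable_finsetSum _ fun j _ => hi i j]
  simp_rw [integral_finsetSum _ fun j _ => hi _ j, integral_const_mul,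
    h.integral_coord_mul_coord_mul_rpow hn hS, ← mul_assoc, ← Finset.sum_mul, htr]
  ring

/-- Pointwise φ^q ln_q φ = (φ - φ^q)/(1 - q), also where φ = 0, and ∫ φ = 1. -/
theorem tsallisEntropy_eq (hq : 1 < q) (h : IsFeasibleDensity q S φ) :
    tsallisEntropy q φ = (powerObjective q φ + 1) / (q - 1) := by
  have hq' : 1 - q ≠ 0 := by linarith
  have e : (fun x => qLog q (φ x) * φ x ^ q) =ᵐ[volume] fun x => (φ x - φ x ^ q) / (1 - q) := by
    filter_upwards [h.nonneg] with x hx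
    unfold qLog
    rcases hx.eq_or_lt with h0 | hpos
    · rw [← h0, Real.zero_rpow (by linarith : q ≠ 0)]; simp
    · rw [div_mul_eq_mul_div, sub_mul, one_mul, ← Real.rpow_add hpos, sub_add_cancel,
        Real.rpow_one]
  rw [tsallisEntropy, qExpectation, integral_congr_ae e, integral_div,
    integral_sub h.integrable (h.integrable_rpow hq), h.integral_eq_one, powerObjective,
    ← neg_sub q 1, div_neg, neg_neg]
  ring

end IsFeasibleDensity

/-! ### Unique maximizers of both objectives -/

theorem isUniqueMaximizer_powerObjective {n : ℕ} (hn : 0 < n) {q : ℝ} (hq : 1 < q)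
    (hqn : q < 1 + 2 / (n : ℝ)) {S : Matrix (Fin n) (Fin n) ℝ} (hS : S.PosDef) :
    IsUniqueMaximizer (powerObjective q) q S (qGaussianDensity q S) := by
  have hm := half_dim_lt hn hq hqn
  have ha : 0 < 2 * (1 / (q - 1)) - (n : ℝ) := by linarith
  have hp := isFeasibleDensity_qGaussianDensity hq hm hS
  have key : ∀ ψ, IsFeasibleDensity q S ψ →
      ∫ x, qGaussianDensity q S x ^ q ≤ ∫ x, ψ x ^ q ∧
      (∫ x, qGaussianDensity q S x ^ q = ∫ x, ψ x ^ q → ψ =ᵐ[volume] qGaussianDensity q S) := by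
    intro ψ hψ
    have h := weighted_rpow_integral_minimal hq (fun x => qWeight_pos ha hS x)
      (qGaussianDensity_pos hq hm hS) (qWeight_mul_qGaussianDensity_rpow hq hm hS) hψ.nonneg
      hp.integrable hψ.integrable (hp.integrable_qWeight_mul_rpow hq _)
      (hψ.integrable_qWeight_mul_rpow hq _) (by rw [hψ.integral_eq_one, hp.integral_eq_one])
    have hc : 0 < 1 + (2 * (1 / (q - 1)) - (n : ℝ))⁻¹ * n := by positivity
    rw [hp.integral_qWeight_mul_rpow hn hq hS, hψ.integral_qWeight_mul_rpow hn hq hS,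
      mul_le_mul_iff_right₀ hc, mul_right_inj' hc.ne'] at h
    exact h
  exact ⟨⟨hp, fun ψ hψ => neg_le_neg (key ψ hψ).1⟩, fun ψ hψ =>
    (key ψ hψ.1).2 (le_antisymm (key ψ hψ.1).1 (neg_le_neg_iff.1 (hψ.2 _ hp)))⟩

theorem isMaximizer_tsallisEntropy_iff {n : ℕ} {q : ℝ} (hq : 1 < q)
    {S : Matrix (Fin n) (Fin n) ℝ} {φ : RVec n → ℝ} :
    IsMaximizer (tsallisEntropy q) q S φ ↔ IsMaximizer (powerObjective q) q S φ := by
  refine and_congr_right fun hφ => forall₂_congr fun ψ hψ => ?_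
  rw [hφ.tsallisEntropy_eq hq, hψ.tsallisEntropy_eq hq, div_le_div_iff_of_pos_right (sub_pos.2 hq),
    add_le_add_iff_right]

theorem mainTheorem5 (n : ℕ) (hn : 0 < n) (q : ℝ) (hq : 1 < q) (hqn : q < 1 + 2 / (n : ℝ))
    (S : Matrix (Fin n) (Fin n) ℝ) (hS : S.PosDef) :
    IsUniqueMaximizer (powerObjective q) q S (qGaussianDensity q S) ∧
      IsUniqueMaximizer (tsallisEntropy q) q S (qGaussianDensity q S) := by
  have h := isUniqueMaximizer_powerObjective hn hq hqn hS
  exact ⟨h, (isMaximizer_tsallisEntropy_iff hq).2 h.1,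
    fun ψ hψ => h.2 ψ ((isMaximizer_tsallisEntropy_iff hq).1 hψ)⟩
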